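/- **Theorem 1.** Let $d\ge 1$ and let $\alpha_1,\beta_1,\dots,\alpha_d,\beta_d$ be positive real numbers. Write $e_1,\dots,e_d$ for the canonical basis of $\mathbb{Z}^d$, and put $w_{e_i}=\alpha_i$, $w_{-e_i}=\beta_i$ for $1\le i\le d$. An environment is a family $\omega=(\omega(x,e))$, $x\in\mathbb{Z}^d$, $e\in\{\pm e_1,\dots,\pm e_d\}$, with $\omega(x,e)>0$ and $\sum_e\omega(x,e)=1$ for every $x$. Let $\mathbb{P}$ be the law on environments under which the vectors $(\omega(x,e))_e$, $x\in\mathbb{Z}^d$, are independent, each with the Dirichlet distribution with parameters $(w_e)_e$, that is, with density $$\frac{\Gamma\left(\sum_e w_e\right)}{\prod_e\Gamma(w_e)}\prod_e p_e^{w_e-1}$$ on $\{p: p_e>0,\ \sum_e p_e=1\}$ with respect to Lebesgue measure in all the coordinates but one. For an environment $\omega$, let $P_o^{\omega}$ be the law of the Markov chain $(X_n)_{n\ge 0}$ on $\mathbb{Z}^d$ with $X_0=0$ and $P_o^\omega(X_{n+1}=x+e\mid X_n=x)=\omega(x,e)$, and let $P_o(\cdot)=\int P_o^{\omega}(\cdot)\,d\mathbb{P}(\omega)$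 be the annealed law. Let $D=\inf\{n\ge 0: X_n\cdot e_1<0\}\in\mathbb{N}\cup\{\infty\}$. If $\alpha_1>\beta_1$, then $$P_o\left(X_n\cdot e_1\to+\infty\right)>0\qquad\text{and}\qquad P_o(D=\infty)\ \ge\ 1-\frac{\beta_1}{\alpha_1}.$$ -/

import Mathlib

open MeasureTheory ProbabilityTheory Filter
open scoped ENNReal

namespace DirichletRWRE

/-! ### The Dirichlet distribution -/

section Dirichlet

variable {J : Type*} [Fintype J]

/-- The open simplex of probability vectors with positive entries indexed by `J`. -/
abbrev OpenSimplex (J : Type*) [Fintype J] : Type _ :=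
  {p : J → ℝ // (∀ j, 0 < p j) ∧ ∑ j, p j = 1}

/-- The density of the Dirichlet distribution with parameters `a`, as a function of the
probability vector `p`:
`Γ(∑ a_j) / ∏ Γ(a_j) * ∏ p_j ^ (a_j - 1)` if all the `p_j` are positive, and `0` otherwise. -/
noncomputable def dirichletDensity (a p : J → ℝ) : ℝ≥0∞ :=
  open Classical in
  if ∀ j, 0 < p j then
    ENNReal.ofReal (Real.Gamma (∑ j, a j) / (∏ j, Real.Gamma (a j)) * ∏ j, p j ^ (a j - 1))
  else 0

variable [DecidableEq J]

/-- The vector with total sum `1` whose coordinates other than `j₀` are given by `u`. -/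
def complete (j₀ : J) (u : {j : J // j ≠ j₀} → ℝ) : J → ℝ :=
  fun j => if h : j = j₀ then 1 - ∑ i, u i else u ⟨j, h⟩

/-- The Dirichlet distribution with parameters `a`, on `J → ℝ`: the coordinates other than `j₀`
have density `dirichletDensity a` with respect to Lebesgue measure, and the coordinate `j₀` makes
the sum equal to `1`. -/
noncomputable def dirichletPi (j₀ : J) (a : J → ℝ) : Measure (J → ℝ) :=
  ((volume : Measure ({j : J // j ≠ j₀} → ℝ)).withDensity
    (fun u => dirichletDensity a (complete j₀ u))).map (complete j₀)

/-- The Dirichlet distribution with parameters `a`, as a measure on the open simplex. -/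
noncomputable def dirichlet (j₀ : J) (a : J → ℝ) : Measure (OpenSimplex J) :=
  (dirichletPi j₀ a).comap Subtype.val

end Dirichlet

/-! ### Random walk in an environment on `ℤ^d` -/

/-- Vertices of the lattice. -/
abbrev Lattice (d : ℕ) : Type := Fin d → ℤ

/-- The `2d` directions: `Sum.inl i` stands for `+e_i`, and `Sum.inr i` for `-e_i`. -/
abbrev Dir (d : ℕ) : Type := Fin d ⊕ Fin d

/-- The unit vector of a direction. -/
def step {d : ℕ} : Dir d → Lattice d
  | Sum.inl i => Pi.single i 1
  | Sum.inr i => -Pi.single i 1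

/-- An environment: at each vertex `x`, positive probabilities `ω x e` of the jumps
from `x` to `x + step e`. -/
abbrev Env (d : ℕ) : Type := Lattice d → OpenSimplex (Dir d)

/-- The law of the position after one step from `x` in the environment `ω`. -/
noncomputable def stepMeasure {d : ℕ} (ω : Env d) (x : Lattice d) : Measure (Lattice d) :=
  ∑ e : Dir d, ENNReal.ofReal ((ω x).1 e) • Measure.dirac (x + step e)

instance {d : ℕ} (ω : Env d) (x : Lattice d) : IsProbabilityMeasure (stepMeasure ω x) := by
  constructor
  simp only [stepMeasure, Measure.coe_finsetSum, Finset.sum_apply, Measure.smul_apply,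
    measure_univ, smul_eq_mul, mul_one]
  rw [← ENNReal.ofReal_sum_of_nonneg (fun e _ => ((ω x).2.1 e).le), (ω x).2.2,
    ENNReal.ofReal_one]

/-- The transition kernel given the past trajectory up to time `n`: it only depends on the
position at time `n`. -/
noncomputable def stepKernel {d : ℕ} (ω : Env d) (n : ℕ) :
    Kernel ((i : Finset.Iic n) → Lattice d) (Lattice d) :=
  Kernel.comap (Kernel.ofFunOfCountable (stepMeasure ω))
    (fun h => h ⟨n, Finset.mem_Iic.2 le_rfl⟩) (measurable_pi_apply _)

instance {d : ℕ} (ω : Env d) (n : ℕ) : IsMarkovKernel (stepKernel ω n) :=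
  ⟨fun _ => inferInstanceAs (IsProbabilityMeasure (stepMeasure ω _))⟩

/-- The quenched law: the law, on the space of trajectories, of the Markov chain started at `x`
with the transition probabilities given by `ω`. -/
noncomputable def quenched {d : ℕ} (x : Lattice d) (ω : Env d) : Measure (ℕ → Lattice d) :=
  Kernel.traj (X := fun _ => Lattice d) (stepKernel ω) 0 (fun _ => x)

/-- The parameters attached to the directions: `α i` for `+e_i` and `β i` for `-e_i`. -/
def weights {d : ℕ} (α β : Fin d → ℝ) : Dir d → ℝ := Sum.elim α β

/-- The law of the i.i.d. Dirichlet environment. -/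
noncomputable def envLaw {d : ℕ} [NeZero d] (α β : Fin d → ℝ) : Measure (Env d) :=
  Measure.infinitePi fun _ => dirichlet (Sum.inl 0) (weights α β)

/-- The annealed law of the walk started at the origin: `A ↦ ∫ P_o^ω(A) d(envLaw)(ω)`. -/
noncomputable def annealed {d : ℕ} [NeZero d] (α β : Fin d → ℝ) : Measure (ℕ → Lattice d) :=
  (envLaw α β).bind (quenched 0)

/-- The first time when the first coordinate of the trajectory is negative
(`⊤` if there is no such time). -/
noncomputable def firstNegTime {d : ℕ} [NeZero d] (X : ℕ → Lattice d) : ℕ∞ :=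
  ⨅ (n : ℕ) (_ : X n 0 < 0), (n : ℕ∞)

/-! ### The objects above are well defined

The Dirichlet distributions have total mass one, and the quenched law is a probability measure
which depends measurably on the environment. -/

/-- The function `t ↦ t ^ (c - 1)` on the positive half-line, extended by zero. -/
noncomputable def powPos (c t : ℝ) : ℝ≥0∞ := if 0 < t then ENNReal.ofReal (t ^ (c - 1)) else 0

theorem measurable_powPos (c : ℝ) : Measurable (powPos c) :=
  Measurable.ite measurableSet_Ioi (by fun_prop) measurable_const

theorem powPos_mul (c : ℝ) {s : ℝ} (hs : 0 < s) (t : ℝ) :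
    powPos c (s * t) = ENNReal.ofReal (s ^ (c - 1)) * powPos c t := by
  unfold powPos
  by_cases ht : 0 < t
  · rw [if_pos (mul_pos hs ht), if_pos ht, ← ENNReal.ofReal_mul (by positivity),
      Real.mul_rpow hs.le ht.le]
  · rw [if_neg (fun h => ht (pos_of_mul_pos_right h hs.le)), if_neg ht, mul_zero]

/-- The integrand of the Gamma integral, extended by zero. -/
noncomputable def gammaFun (c : ℝ) : ℝ → ℝ :=
  (Set.Ioi (0 : ℝ)).indicator fun t => Real.exp (-t) * t ^ (c - 1)

theorem gammaFun_nonneg (c t : ℝ) : 0 ≤ gammaFun c t :=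
  Set.indicator_nonneg (fun t (ht : 0 < t) => by positivity) t

theorem powPos_mul_exp (c t : ℝ) :
    powPos c t * ENNReal.ofReal (Real.exp (-t)) = ENNReal.ofReal (gammaFun c t) := by
  by_cases ht : 0 < t
  · rw [gammaFun, Set.indicator_of_mem (Set.mem_Ioi.2 ht), powPos, if_pos ht, mul_comm,
      ENNReal.ofReal_mul (Real.exp_nonneg _)]
  · rw [gammaFun, Set.indicator_of_notMem (by simpa using ht), powPos, if_neg ht, zero_mul,
      ENNReal.ofReal_zero]

theorem integrable_gammaFun {c : ℝ} (hc : 0 < c) : Integrable (gammaFun c) :=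
  (integrable_indicator_iff measurableSet_Ioi).2 (Real.GammaIntegral_convergent hc)

theorem integral_gammaFun {c : ℝ} (hc : 0 < c) : ∫ t, gammaFun c t = Real.Gamma c := by
  rw [Real.Gamma_eq_integral hc]
  exact integral_indicator measurableSet_Ioi

theorem lintegral_powPos_exp {c : ℝ} (hc : 0 < c) :
    ∫⁻ t, powPos c t * ENNReal.ofReal (Real.exp (-t)) = ENNReal.ofReal (Real.Gamma c) := by
  simp_rw [powPos_mul_exp]
  rw [← integral_gammaFun hc, ofReal_integral_eq_lintegral_ofReal (integrable_gammaFun hc)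
    (Eventually.of_forall (gammaFun_nonneg c))]

theorem lintegral_prod_powPos_exp {ι : Type*} [Fintype ι] {a : ι → ℝ} (ha : ∀ i, 0 < a i) :
    ∫⁻ x : ι → ℝ, ∏ i, (powPos (a i) (x i) * ENNReal.ofReal (Real.exp (-x i))) =
      ∏ i, ENNReal.ofReal (Real.Gamma (a i)) := by
  simp_rw [powPos_mul_exp, ← fun i => integral_gammaFun (ha i)]
  rw [← ENNReal.ofReal_prod_of_nonneg
      (fun i _ => integral_nonneg (gammaFun_nonneg (a i))),
    ← integral_fintype_prod_volume_eq_prod, volume_pi, ofReal_integral_eq_lintegral_ofReal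
      (Integrable.fintype_prod fun i => integrable_gammaFun (ha i))
      (Eventually.of_forall fun x => Finset.prod_nonneg fun i _ => gammaFun_nonneg _ _)]
  exact lintegral_congr fun x =>
    (ENNReal.ofReal_prod_of_nonneg fun i _ => gammaFun_nonneg _ _).symm

/-- Dirichlet's integral. -/
theorem dirichlet_integral {ι : Type*} [Fintype ι] {a : ι → ℝ} (ha : ∀ i, 0 < a i) {b : ℝ}
    (hb : 0 < b) :
    ENNReal.ofReal (Real.Gamma (∑ i, a i + b)) *
      ∫⁻ x : ι → ℝ, (∏ i, powPos (a i) (x i)) * powPos b (1 - ∑ i, x i) =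
      (∏ i, ENNReal.ofReal (Real.Gamma (a i))) * ENNReal.ofReal (Real.Gamma b) := by
  have mP : Measurable fun x : ι → ℝ => ∏ i, powPos (a i) (x i) :=
    Finset.measurable_fun_prod _ fun i _ => (measurable_powPos _).comp (measurable_pi_apply i)
  have mb := measurable_powPos b
  have mI : ∀ s : ℝ, Measurable fun x : ι → ℝ =>
      (∏ i, powPos (a i) (x i)) * powPos b (s - ∑ i, x i) :=
    fun s => mP.mul (mb.comp (by fun_prop))
  -- the scaling identity
  have hscale : ∀ s : ℝ, ∫⁻ x : ι → ℝ, (∏ i, powPos (a i) (x i)) * powPos b (s - ∑ i, x i) =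
      powPos (∑ i, a i + b) s *
        ∫⁻ x : ι → ℝ, (∏ i, powPos (a i) (x i)) * powPos b (1 - ∑ i, x i) := by
    intro s
    by_cases hs : 0 < s
    · have hmap := Measure.map_addHaar_smul (volume : Measure (ι → ℝ)) hs.ne'
      have h2 := lintegral_map (μ := (volume : Measure (ι → ℝ))) (mI s)
        (measurable_const_smul s)
      rw [hmap, lintegral_smul_measure] at h2
      have h3 : ∀ x : ι → ℝ, (∏ i, powPos (a i) ((s • x) i)) * powPos b (s - ∑ i, (s • x) i) =
          ENNReal.ofReal ((∏ i, s ^ (a i - 1)) * s ^ (b - 1)) *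
            ((∏ i, powPos (a i) (x i)) * powPos b (1 - ∑ i, x i)) := by
        intro x
        have : s - ∑ i, (s • x) i = s * (1 - ∑ i, x i) := by
          simp [mul_sub, Finset.mul_sum]
        rw [this, powPos_mul b hs]
        simp only [Pi.smul_apply, smul_eq_mul, powPos_mul _ hs, Finset.prod_mul_distrib]
        rw [ENNReal.ofReal_mul (by positivity), ENNReal.ofReal_prod_of_nonneg
          (fun i _ => by positivity)]
        ring
      simp_rw [h3] at h2
      rw [lintegral_const_mul _ (mI 1), smul_eq_mul] at h2
      have h4 : ENNReal.ofReal |(s ^ Module.finrank ℝ (ι → ℝ))⁻¹| ≠ 0 := by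
        simp [hs.ne']
      have h5 : ENNReal.ofReal ((∏ i, s ^ (a i - 1)) * s ^ (b - 1)) =
          ENNReal.ofReal |(s ^ Module.finrank ℝ (ι → ℝ))⁻¹| * powPos (∑ i, a i + b) s := by
        rw [powPos, if_pos hs, ← ENNReal.ofReal_mul (by positivity)]
        congr 1
        rw [abs_of_pos (by positivity), Module.finrank_fintype_fun_eq_card,
          ← Real.rpow_sum_of_pos hs, ← Real.rpow_natCast, ← Real.rpow_neg hs.le,
          ← Real.rpow_add hs, ← Real.rpow_add hs]
        congr 1
        simp only [Finset.sum_sub_distrib, Finset.sum_const, Finset.card_univ, nsmul_eq_mul]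
        ring
      rw [h5, mul_assoc] at h2
      exact (ENNReal.mul_right_inj h4 ENNReal.ofReal_ne_top).1 h2
    · rw [powPos, if_neg hs, zero_mul]
      refine (lintegral_congr fun x => ?_).trans lintegral_zero
      by_cases hx : ∀ i, 0 < x i
      · have : 0 ≤ ∑ i, x i := Finset.sum_nonneg fun i _ => (hx i).le
        rw [powPos, if_neg (by linarith), mul_zero]
      · push Not at hx
        obtain ⟨i, hi⟩ := hx
        rw [Finset.prod_eq_zero (Finset.mem_univ i) (by rw [powPos, if_neg hi.not_gt]), zero_mul]
  have mE : Measurable fun x : ι → ℝ =>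
      ∏ i, (powPos (a i) (x i) * ENNReal.ofReal (Real.exp (-x i))) :=
    Finset.measurable_fun_prod _ fun i _ =>
      ((measurable_powPos _).comp (measurable_pi_apply i)).mul (by fun_prop)
  rw [← lintegral_prod_powPos_exp ha, ← lintegral_powPos_exp hb, ← lintegral_mul_const _ mE]
  have hx : ∀ x : ι → ℝ,
      (∏ i, (powPos (a i) (x i) * ENNReal.ofReal (Real.exp (-x i)))) *
        ∫⁻ t, powPos b t * ENNReal.ofReal (Real.exp (-t)) =
      ∫⁻ s, (∏ i, powPos (a i) (x i)) * powPos b (s - ∑ i, x i) *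
        ENNReal.ofReal (Real.exp (-s)) := by
    intro x
    have mB : Measurable fun t => powPos b t * ENNReal.ofReal (Real.exp (-t)) :=
      mb.mul (by fun_prop)
    have mC : Measurable fun t => powPos b (t - ∑ i, x i) *
        ENNReal.ofReal (Real.exp (-(t - ∑ i, x i))) := mB.comp (measurable_sub_const _)
    rw [← lintegral_sub_right_eq_self (fun t => powPos b t * ENNReal.ofReal (Real.exp (-t)))
      (∑ i, x i), ← lintegral_const_mul _ mC]
    refine lintegral_congr fun s => ?_
    have : Real.exp (-s) = (∏ i, Real.exp (-x i)) * Real.exp (-(s - ∑ i, x i)) := by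
      rw [← Real.exp_sum, ← Real.exp_add]
      congr 1
      rw [Finset.sum_neg_distrib]
      ring
    rw [this, ENNReal.ofReal_mul (by positivity), ENNReal.ofReal_prod_of_nonneg
      (fun i _ => by positivity), Finset.prod_mul_distrib]
    ring
  simp_rw [hx]
  rw [lintegral_lintegral_swap]
  · have : ∀ s : ℝ, ∫⁻ x : ι → ℝ, (∏ i, powPos (a i) (x i)) * powPos b (s - ∑ i, x i) *
        ENNReal.ofReal (Real.exp (-s)) = powPos (∑ i, a i + b) s *
          ENNReal.ofReal (Real.exp (-s)) *
        ∫⁻ x : ι → ℝ, (∏ i, powPos (a i) (x i)) * powPos b (1 - ∑ i, x i) := by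
      intro s
      rw [lintegral_mul_const _ (mI s), hscale]
      ring
    simp_rw [this]
    have mB : Measurable fun t => powPos (∑ i, a i + b) t * ENNReal.ofReal (Real.exp (-t)) :=
      (measurable_powPos _).mul (by fun_prop)
    rw [lintegral_mul_const _ mB, lintegral_powPos_exp]
    exact add_pos_of_nonneg_of_pos (Finset.sum_nonneg fun i _ => (ha i).le) hb
  · refine Measurable.aemeasurable ?_
    exact ((mP.comp measurable_fst).mul (mb.comp (by fun_prop))).mul (by fun_prop)

section
variable {J : Type*} [Fintype J] [DecidableEq J]

theorem measurable_complete (j₀ : J) : Measurable (complete j₀) := by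
  refine measurable_pi_lambda _ fun j => ?_
  by_cases h : j = j₀
  · simp only [complete, h, dite_true]
    fun_prop
  · simp only [complete, h, dite_false]
    fun_prop

theorem sum_complete (j₀ : J) (u : {j : J // j ≠ j₀} → ℝ) : ∑ j, complete j₀ u j = 1 := by
  have h : ∀ i : {j : J // j ≠ j₀}, complete j₀ u i = u i := fun i => dif_neg i.2
  have h0 : complete j₀ u j₀ = 1 - ∑ i, u i := dif_pos rfl
  rw [Fintype.sum_eq_add_sum_subtype_ne _ j₀, h0]
  simp_rw [h]
  ring

theorem dirichletDensity_complete (j₀ : J) (a : J → ℝ) (u : {j : J // j ≠ j₀} → ℝ) :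
    dirichletDensity a (complete j₀ u) =
      ENNReal.ofReal (Real.Gamma (∑ j, a j) / (∏ j, Real.Gamma (a j))) *
        ((∏ i, powPos (a i.1) (u i)) * powPos (a j₀) (1 - ∑ i, u i)) := by
  have h : ∀ i : {j : J // j ≠ j₀}, complete j₀ u i = u i := fun i => dif_neg i.2
  have h0 : complete j₀ u j₀ = 1 - ∑ i, u i := dif_pos rfl
  have hprod : (∏ i, powPos (a i.1) (u i)) * powPos (a j₀) (1 - ∑ i, u i) =
      ∏ j, powPos (a j) (complete j₀ u j) := by
    rw [Fintype.prod_eq_mul_prod_subtype_ne _ j₀, h0, mul_comm]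
    simp_rw [h]
  rw [hprod, dirichletDensity]
  split_ifs with hu
  · rw [ENNReal.ofReal_mul' (Finset.prod_nonneg fun j _ => Real.rpow_nonneg (hu j).le _),
      ENNReal.ofReal_prod_of_nonneg fun j _ => Real.rpow_nonneg (hu j).le _]
    congr 1
    exact Finset.prod_congr rfl fun j _ => (if_pos (hu j)).symm
  · push Not at hu
    obtain ⟨j, hj⟩ := hu
    have hz : powPos (a j) (complete j₀ u j) = 0 := if_neg hj.not_gt
    rw [Finset.prod_eq_zero (f := fun j => powPos (a j) (complete j₀ u j))
      (Finset.mem_univ j) hz, mul_zero]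

theorem lintegral_dirichletDensity (j₀ : J) {a : J → ℝ} (ha : ∀ j, 0 < a j) :
    ∫⁻ u, dirichletDensity a (complete j₀ u) = 1 := by
  have mI : Measurable fun u : {j : J // j ≠ j₀} → ℝ =>
      (∏ i, powPos (a i.1) (u i)) * powPos (a j₀) (1 - ∑ i, u i) :=
    (Finset.measurable_fun_prod _ fun i _ =>
      (measurable_powPos _).comp (measurable_pi_apply i)).mul
      ((measurable_powPos _).comp (by fun_prop))
  have hs : ∑ j, a j = ∑ i : {j : J // j ≠ j₀}, a i.1 + a j₀ := by
    rw [Fintype.sum_eq_add_sum_subtype_ne _ j₀, add_comm]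
  have hp : ∏ j, Real.Gamma (a j) =
      (∏ i : {j : J // j ≠ j₀}, Real.Gamma (a i.1)) * Real.Gamma (a j₀) := by
    rw [Fintype.prod_eq_mul_prod_subtype_ne _ j₀, mul_comm]
  have hG : ∀ j, 0 < Real.Gamma (a j) := fun j => Real.Gamma_pos_of_pos (ha j)
  have hP : 0 < ∏ j, Real.Gamma (a j) := Finset.prod_pos fun j _ => hG j
  simp_rw [dirichletDensity_complete]
  rw [lintegral_const_mul _ mI, div_eq_inv_mul, ENNReal.ofReal_mul (by positivity), hs, mul_assoc,
    dirichlet_integral (a := fun i : {j : J // j ≠ j₀} => a i.1) (fun i => ha i.1) (ha j₀),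
    ← ENNReal.ofReal_prod_of_nonneg (fun i _ => (hG i.1).le),
    ← ENNReal.ofReal_mul (Finset.prod_nonneg fun i _ => (hG i.1).le), ← hp,
    ← ENNReal.ofReal_mul (by positivity), inv_mul_cancel₀ hP.ne', ENNReal.ofReal_one]

/-- For positive parameters, the Dirichlet distribution is a probability measure. -/
theorem isProbabilityMeasure_dirichlet (j₀ : J) {a : J → ℝ} (ha : ∀ j, 0 < a j) :
    IsProbabilityMeasure (dirichlet j₀ a) := by
  have hm : MeasurableSet {p : J → ℝ | (∀ j, 0 < p j) ∧ ∑ j, p j = 1} := by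
    measurability
  have he : MeasurableEmbedding (Subtype.val : OpenSimplex J → J → ℝ) :=
    MeasurableEmbedding.subtype_coe hm
  constructor
  rw [dirichlet, he.comap_apply, Set.image_univ, Subtype.range_coe_subtype, dirichletPi,
    Measure.map_apply (measurable_complete j₀) hm,
    withDensity_apply _ (measurable_complete j₀ hm), ← lintegral_dirichletDensity j₀ ha,
    ← lintegral_indicator (measurable_complete j₀ hm)]
  refine lintegral_congr fun u => ?_
  by_cases hu : ∀ j, 0 < complete j₀ u j
  · have hmem : u ∈ complete j₀ ⁻¹' {p : J → ℝ | (∀ j, 0 < p j) ∧ ∑ j, p j = 1} :=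
      ⟨hu, sum_complete j₀ u⟩
    exact Set.indicator_of_mem hmem _
  · rw [Set.indicator_of_notMem fun h => hu h.1, dirichletDensity, if_neg hu]

end

theorem measurable_stepMeasure {d : ℕ} (x : Lattice d) (B : Set (Lattice d)) :
    Measurable fun ω : Env d => stepMeasure ω x B := by
  simp only [stepMeasure, Measure.coe_finsetSum, Finset.sum_apply, Measure.smul_apply,
    smul_eq_mul]
  refine Finset.measurable_fun_sum _ fun e _ => Measurable.mul_const ?_ _
  exact ENNReal.measurable_ofReal.comp ((measurable_pi_apply e).comp
    (measurable_subtype_coe.comp (measurable_pi_apply x)))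

theorem measurable_partialTraj {d : ℕ} (b : ℕ) (x₀ : (i : Finset.Iic 0) → Lattice d)
    (B : Set ((i : Finset.Iic b) → Lattice d)) :
    Measurable fun ω : Env d =>
      Kernel.partialTraj (X := fun _ => Lattice d) (stepKernel ω) 0 b x₀ B := by
  induction b with
  | zero =>
    simp only [Kernel.partialTraj_self]
    exact measurable_const
  | succ b ih =>
    have hB : MeasurableSet B := .of_discrete
    have h : ∀ ω : Env d,
        Kernel.partialTraj (X := fun _ => Lattice d) (stepKernel ω) 0 (b + 1) x₀ B =
        ∑' h : (i : Finset.Iic b) → Lattice d,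
          stepMeasure ω (h ⟨b, Finset.mem_Iic.2 le_rfl⟩)
            {y | IicProdIoc (X := fun _ => Lattice d) b (b + 1)
              (h, MeasurableEquiv.piSingleton (X := fun _ => Lattice d) b y) ∈ B} *
          Kernel.partialTraj (X := fun _ => Lattice d) (stepKernel ω) 0 b x₀ {h} := by
      intro ω
      rw [Kernel.partialTraj_succ_of_le (Nat.zero_le b), Kernel.map_apply' _ (by fun_prop) _ hB,
        Kernel.comp_apply' _ _ _ .of_discrete, lintegral_countable']
      refine tsum_congr fun h => ?_
      congr 1
      rw [Kernel.prod_apply, Kernel.id_apply, Measure.dirac_prod,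
        Measure.map_apply (by fun_prop) .of_discrete, Kernel.map_apply' _ (by fun_prop) _ .of_discrete]
      rfl
    simp_rw [h]
    exact Measurable.tsum fun h => (measurable_stepMeasure _ _).mul (ih _)

theorem isProbabilityMeasure_quenched {d : ℕ} (x : Lattice d) (ω : Env d) :
    IsProbabilityMeasure (quenched x ω) := by
  unfold quenched
  infer_instance

/-- The quenched law depends measurably on the environment. -/
theorem measurable_quenched {d : ℕ} (x : Lattice d) :
    Measurable (quenched x : Env d → Measure (ℕ → Lattice d)) := by
  have := isProbabilityMeasure_quenched x
  refine Measurable.measure_of_isPiSystem_of_isProbabilityMeasure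
    (generateFrom_measurableCylinders (α := fun _ : ℕ => Lattice d)).symm
    isPiSystem_measurableCylinders fun A hA => ?_
  rw [measurableCylinders_nat] at hA
  simp only [Set.mem_iUnion, Set.mem_singleton_iff] at hA
  obtain ⟨n, S, hS, rfl⟩ := hA
  have h : ∀ ω : Env d, quenched x ω (cylinder (Finset.Iic n) S) =
      Kernel.partialTraj (X := fun _ => Lattice d) (stepKernel ω) 0 n (fun _ => x) S := by
    intro ω
    rw [← Kernel.traj_map_frestrictLe_apply, Measure.map_apply (by fun_prop) hS]
    rfl
  simp_rw [h]
  exact measurable_partialTraj n _ S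

/-- The law of the environment is a probability measure. -/
theorem isProbabilityMeasure_envLaw {d : ℕ} [NeZero d] {α β : Fin d → ℝ} (hα : ∀ i, 0 < α i)
    (hβ : ∀ i, 0 < β i) : IsProbabilityMeasure (envLaw α β) := by
  have := isProbabilityMeasure_dirichlet (Sum.inl 0) (a := weights α β)
    (by rintro (i | i) <;> simp [weights, hα, hβ])
  unfold envLaw
  infer_instance

/-- The annealed probability of an event is the mean of its quenched probabilities. -/
theorem annealed_apply {d : ℕ} [NeZero d] (α β : Fin d → ℝ) {A : Set (ℕ → Lattice d)}
    (hA : MeasurableSet A) :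
    annealed α β A = ∫⁻ ω, quenched 0 ω A ∂(envLaw α β) :=
  Measure.bind_apply hA (measurable_quenched 0).aemeasurable

end DirichletRWRE

/-!
The proof uses only the annealed law. Since the environment is i.i.d. Dirichlet, integrating it out
turns the walk into a directed edge reinforced walk: the annealed probability of a finite path is an
explicit product (`annealed_pathCylinder_pos`), in which the numerator depends only on the numbers of
crossings of the oriented edges, and the denominator only on the numbers of visits to the sites.

*Probability of reaching level `-1`.* A path from the origin which stays at levels `≥ 0`, comes back
to level `0` and then makes the step `-e_1` can be read backwards, after translation, as a path of
the same kind, each step `e` becoming `-e`. If moreover the parameters `α` and `β` are exchanged,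
the crossing counts are carried by oriented edges of the same weight, and the numbers of visits are
also preserved because the sum of the parameters is the same at all sites. Only the factor of the
final step changes, from `β 0` to `α 0` (`IsExcursion.pathWeight_reverse`). Summing over paths, the
probability of reaching level `-1` is `β 0 / α 0` times the probability of the same event for the
exchanged parameters, hence is at most `β 0 / α 0` (`annealed_exists_neg_le`).

*Transience.* Given the past, the annealed probability of a step `-e_1` from a site visited `N` times
before is at least `β 0 / (W + N)`, where `W` is the sum of the parameters, and `N` is at most the
number of earlier visits to the level of that site. These bounds have a divergent sum along the
visits to a given level if there are infinitely many of them, so that, by Lévy's conditional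
Borel-Cantelli lemma, the next lower level is then visited infinitely often as well
(`ae_frequently_level_pred`). A walk which stays at levels `≥ 0` therefore visits each level finitely
often, that is, its level tends to infinity.
-/

namespace DirichletRWRE

/-! ### Counting visits of a finite sequence -/

section Counting

variable {Y Z : Type*} [DecidableEq Y] [DecidableEq Z]

/-- The number of times `k < n` at which the sequence `y` takes the value `z`. -/
def visits (y : ℕ → Y) (n : ℕ) (z : Y) : ℕ := ((Finset.range n).filter fun k => y k = z).card

theorem visits_zero (y : ℕ → Y) (z : Y) : visits y 0 z = 0 := by simp [visits]

theorem visits_succ (y : ℕ → Y) (n : ℕ) (z : Y) :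
    visits y (n + 1) z = visits y n z + if y n = z then 1 else 0 := by
  rw [visits, visits, Finset.range_add_one, Finset.filter_insert]
  split_ifs with h
  · rw [Finset.card_insert_of_notMem (by simp)]
  · rfl

theorem visits_congr {y y' : ℕ → Y} {n : ℕ} (h : ∀ k < n, y k = y' k) (z : Y) :
    visits y n z = visits y' n z := by
  unfold visits
  congr 1
  exact Finset.filter_congr fun k hk => by rw [h k (Finset.mem_range.1 hk)]

theorem sum_visits_prodMk [Fintype Z] (x : ℕ → Y) (s : ℕ → Z) (n : ℕ) (v : Y) :
    ∑ e, visits (fun k => (x k, s k)) n (v, e) = visits x n v := by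
  unfold visits
  rw [Finset.card_eq_sum_card_fiberwise (f := s) (t := Finset.univ) (by simp)]
  refine Finset.sum_congr rfl fun e _ => ?_
  rw [Finset.filter_filter]
  simp only [Prod.mk.injEq]

/-- A product over times, in which the factor at time `k` depends on the current value and on the
number of previous visits to it, is a product over the values. -/
theorem prod_range_visits {M : Type*} [CommMonoid M] (g : Y → ℕ → M) (y : ℕ → Y) (n : ℕ)
    (F : Finset Y) (hF : ∀ k < n, y k ∈ F) :
    ∏ k ∈ Finset.range n, g (y k) (visits y k (y k)) =
      ∏ z ∈ F, ∏ i ∈ Finset.range (visits y n z), g z i := by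
  induction n with
  | zero => simp [visits_zero]
  | succ n ih =>
    have h : ∀ z, ∏ i ∈ Finset.range (visits y (n + 1) z), g z i =
        (∏ i ∈ Finset.range (visits y n z), g z i) * if y n = z then g z (visits y n z) else 1 := by
      intro z
      rw [visits_succ]
      split_ifs with h
      · rw [Finset.prod_range_succ]
      · simp
    simp_rw [h]
    rw [Finset.prod_mul_distrib, Finset.prod_range_succ,
      ih fun k hk => hF k (hk.trans n.lt_succ_self), Finset.prod_ite_eq, if_pos (hF n n.lt_succ_self)]

/-- Such a product does not change when the sequence is run backwards and relabelled. -/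
theorem prod_range_visits_reverse {M : Type*} [CommMonoid M] {g : Y → ℕ → M} {g' : Z → ℕ → M}
    {y : ℕ → Y} {y' : ℕ → Z} {φ : Y → Z} (hφ : Function.Injective φ) {n : ℕ}
    (hy : ∀ k < n, y' k = φ (y (n - 1 - k))) (hg : ∀ z i, g' (φ z) i = g z i) :
    ∏ k ∈ Finset.range n, g' (y' k) (visits y' k (y' k)) =
      ∏ k ∈ Finset.range n, g (y k) (visits y k (y k)) := by
  have hF : ∀ k < n, y k ∈ (Finset.range n).image y := fun k hk =>
    Finset.mem_image_of_mem _ (Finset.mem_range.2 hk)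
  have hv : ∀ z, visits y' n (φ z) = visits y n z := by
    intro z
    refine Finset.card_bij' (fun k _ => n - 1 - k) (fun k _ => n - 1 - k) ?_ ?_ ?_ ?_
    · intro k hk
      simp only [Finset.mem_filter, Finset.mem_range] at hk ⊢
      exact ⟨by omega, hφ (by rw [← hy k hk.1, hk.2])⟩
    · intro k hk
      simp only [Finset.mem_filter, Finset.mem_range] at hk ⊢
      refine ⟨by omega, ?_⟩
      rw [hy _ (by omega), show n - 1 - (n - 1 - k) = k by omega, hk.2]
    · intro k hk
      simp only [Finset.mem_filter, Finset.mem_range] at hk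
      omega
    · intro k hk
      simp only [Finset.mem_filter, Finset.mem_range] at hk
      omega
  rw [prod_range_visits g y n _ hF, prod_range_visits g' y' n (((Finset.range n).image y).image φ),
    Finset.prod_image hφ.injOn]
  · simp_rw [hv, hg]
  · intro k hk
    rw [hy k hk]
    exact Finset.mem_image_of_mem _ (hF _ (by omega))

end Counting

/-! ### Moments of the Dirichlet distribution -/

section Moments

variable {J : Type*} [Fintype J]

theorem Gamma_add_natCast {a : ℝ} (ha : 0 < a) (n : ℕ) :
    Real.Gamma (a + n) = (∏ i ∈ Finset.range n, (a + i)) * Real.Gamma a := by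
  induction n with
  | zero => simp
  | succ n ih =>
    rw [Finset.prod_range_succ, Nat.cast_succ, ← add_assoc, Real.Gamma_add_one (by positivity), ih]
    ring

/-- Multiplying a Dirichlet density by a monomial shifts its parameters, up to a constant. -/
theorem dirichletDensity_mul_prod_pow [Nonempty J] {a : J → ℝ} (ha : ∀ j, 0 < a j) (n : J → ℕ)
    (p : J → ℝ) :
    dirichletDensity a p * ∏ j, ENNReal.ofReal (p j) ^ n j =
      ENNReal.ofReal ((∏ j, ∏ i ∈ Finset.range (n j), (a j + i)) /
        ∏ i ∈ Finset.range (∑ j, n j), (∑ j, a j + i)) *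
      dirichletDensity (fun j => a j + n j) p := by
  unfold dirichletDensity
  split_ifs with hp
  · have hA : 0 < ∑ j, a j := Finset.sum_pos (fun j _ => ha j) Finset.univ_nonempty
    have hG : ∀ j, 0 < Real.Gamma (a j) := fun j => Real.Gamma_pos_of_pos (ha j)
    have hGA : 0 < Real.Gamma (∑ j, a j) := Real.Gamma_pos_of_pos hA
    have hP : 0 < ∏ j, Real.Gamma (a j) := Finset.prod_pos fun j _ => hG j
    have hr : ∀ j, 0 < ∏ i ∈ Finset.range (n j), (a j + i) := fun j =>
      Finset.prod_pos fun i _ => by have := ha j; positivity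
    have hR : 0 < ∏ j, ∏ i ∈ Finset.range (n j), (a j + i) := Finset.prod_pos fun j _ => hr j
    have hRA : 0 < ∏ i ∈ Finset.range (∑ j, n j), (∑ j, a j + i) :=
      Finset.prod_pos fun i _ => by positivity
    have hpow : ∏ j, p j ^ (a j + n j - 1) = (∏ j, p j ^ (a j - 1)) * ∏ j, p j ^ n j := by
      rw [← Finset.prod_mul_distrib]
      refine Finset.prod_congr rfl fun j _ => ?_
      rw [← Real.rpow_add_natCast (hp j).ne']
      congr 1
      ring
    rw [Finset.sum_add_distrib, ← Nat.cast_sum, Gamma_add_natCast hA, hpow]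
    simp_rw [fun j => Gamma_add_natCast (ha j) (n j)]
    rw [Finset.prod_mul_distrib]
    simp_rw [← fun j => ENNReal.ofReal_pow (hp j).le (n j)]
    have hX : 0 ≤ ∏ j, p j ^ n j := Finset.prod_nonneg fun j _ => pow_nonneg (hp j).le _
    have hY : 0 ≤ ∏ j, p j ^ (a j - 1) := Finset.prod_nonneg fun j _ => Real.rpow_nonneg (hp j).le _
    rw [← ENNReal.ofReal_prod_of_nonneg (fun j _ => pow_nonneg (hp j).le _),
      ← ENNReal.ofReal_mul (by positivity), ← ENNReal.ofReal_mul (by positivity)]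
    congr 1
    field_simp
  · simp

variable [DecidableEq J]

theorem lintegral_dirichlet (j₀ : J) (a : J → ℝ) {f : (J → ℝ) → ℝ≥0∞} (hf : Measurable f) :
    ∫⁻ p, f p.1 ∂(dirichlet j₀ a) =
      ∫⁻ u, dirichletDensity a (complete j₀ u) * f (complete j₀ u) := by
  have hm : MeasurableSet {p : J → ℝ | (∀ j, 0 < p j) ∧ ∑ j, p j = 1} := by
    measurability
  have he : MeasurableEmbedding (Subtype.val : OpenSimplex J → J → ℝ) :=
    MeasurableEmbedding.subtype_coe hm
  have hd : Measurable fun u => dirichletDensity a (complete j₀ u) := by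
    simp_rw [dirichletDensity_complete]
    exact ((Finset.measurable_fun_prod _ fun i _ =>
      (measurable_powPos _).comp (measurable_pi_apply i)).mul
      ((measurable_powPos _).comp (by fun_prop))).const_mul _
  rw [← he.lintegral_map, dirichlet, he.map_comap, Subtype.range_coe_subtype,
    ← lintegral_indicator hm, dirichletPi, lintegral_map (hf.indicator hm) (measurable_complete j₀)]
  refine (lintegral_withDensity_eq_lintegral_mul _ hd
    ((hf.indicator hm).comp (measurable_complete j₀))).trans (lintegral_congr fun u => ?_)
  by_cases hu : ∀ j, 0 < complete j₀ u j
  · have hmem : complete j₀ u ∈ {p : J → ℝ | (∀ j, 0 < p j) ∧ ∑ j, p j = 1} :=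
      ⟨hu, sum_complete j₀ u⟩
    rw [Pi.mul_apply, Function.comp_apply, Set.indicator_of_mem hmem]
  · rw [Pi.mul_apply, dirichletDensity, if_neg hu, zero_mul, zero_mul]

theorem lintegral_dirichlet_prod_pow (j₀ : J) {a : J → ℝ} (ha : ∀ j, 0 < a j) (n : J → ℕ) :
    ∫⁻ p, ∏ j, ENNReal.ofReal (p.1 j) ^ n j ∂(dirichlet j₀ a) =
      ENNReal.ofReal ((∏ j, ∏ i ∈ Finset.range (n j), (a j + i)) /
        ∏ i ∈ Finset.range (∑ j, n j), (∑ j, a j + i)) := by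
  have : Nonempty J := ⟨j₀⟩
  rw [lintegral_dirichlet j₀ a (f := fun p => ∏ j, ENNReal.ofReal (p j) ^ n j) (by fun_prop)]
  simp_rw [dirichletDensity_mul_prod_pow ha]
  rw [lintegral_const_mul' _ _ ENNReal.ofReal_ne_top,
    lintegral_dirichletDensity j₀ (fun j => by have := ha j; positivity), mul_one]

end Moments

/-! ### Steps and cylinders -/

section Paths

variable {d : ℕ}

theorem step_injective : Function.Injective (step : Dir d → Lattice d) := by
  rintro (i | i) (j | j) h
  · have := congrFun h i
    by_cases hij : i = j
    · rw [hij]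
    · simp [step, hij] at this
  · have := congrFun h i
    by_cases hij : i = j
    · subst hij; simp [step] at this
    · simp [step, hij] at this
  · have := congrFun h i
    by_cases hij : i = j
    · subst hij; simp [step] at this
    · simp [step, hij] at this
  · have := congrFun h i
    by_cases hij : i = j
    · rw [hij]
    · simp [step, hij] at this

theorem step_swap (e : Dir d) : step e.swap = -step e := by
  rcases e with i | i <;> simp [step]

theorem step_apply_zero_neg_iff [NeZero d] (e : Dir d) : step e 0 < 0 ↔ e = Sum.inr 0 := by
  rcases e with i | i
  · by_cases hi : i = 0
    · subst hi; simp [step]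
    · simp [step, Ne.symm hi]
  · by_cases hi : i = 0
    · subst hi; simp [step]
    · simp [step, Ne.symm hi, hi]

theorem step_inr_zero_apply_zero [NeZero d] : step (Sum.inr 0 : Dir d) 0 = -1 := by
  simp [step]

theorem stepMeasure_add_step (ω : Env d) (x : Lattice d) (e : Dir d) :
    stepMeasure ω x {x + step e} = ENNReal.ofReal ((ω x).1 e) := by
  simp only [stepMeasure, Measure.coe_finsetSum, Finset.sum_apply, Measure.smul_apply, smul_eq_mul]
  rw [Finset.sum_eq_single e]
  · simp
  · intro e' _ he
    simp [step_injective.ne he]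
  · simp

theorem stepMeasure_of_forall_ne (ω : Env d) (x y : Lattice d) (h : ∀ e, y ≠ x + step e) :
    stepMeasure ω x {y} = 0 := by
  simp only [stepMeasure, Measure.coe_finsetSum, Finset.sum_apply, Measure.smul_apply, smul_eq_mul]
  refine Finset.sum_eq_zero fun e _ => ?_
  simp [(h e).symm]

/-- The trajectories which agree with `γ` up to time `n`. -/
def pathCylinder (γ : ℕ → Lattice d) (n : ℕ) : Set (ℕ → Lattice d) := {X | ∀ k ≤ n, X k = γ k}

theorem pathCylinder_eq_preimage (γ : ℕ → Lattice d) (n : ℕ) :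
    pathCylinder γ n = Preorder.frestrictLe (π := fun _ => Lattice d) n ⁻¹' {fun i => γ i.1} := by
  ext X
  simp [pathCylinder, funext_iff]

theorem measurableSet_pathCylinder (γ : ℕ → Lattice d) (n : ℕ) :
    MeasurableSet (pathCylinder γ n) := by
  rw [pathCylinder_eq_preimage]
  exact (Preorder.measurable_frestrictLe n) .of_discrete

theorem pathCylinder_congr {γ γ' : ℕ → Lattice d} {n : ℕ} (h : ∀ k ≤ n, γ k = γ' k) :
    pathCylinder γ n = pathCylinder γ' n := by
  ext X
  exact forall₂_congr fun k hk => by rw [h k hk]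

theorem pathCylinder_succ (γ : ℕ → Lattice d) (n : ℕ) :
    pathCylinder γ (n + 1) = pathCylinder γ n ∩ {X | X (n + 1) = γ (n + 1)} := by
  ext X
  constructor
  · exact fun h => ⟨fun k hk => h k (by omega), h _ le_rfl⟩
  · rintro ⟨h, h'⟩ k hk
    rcases Nat.le_succ_iff.1 hk with hk | rfl
    · exact h k hk
    · exact h'

/-- The Markov property of the quenched walk at a deterministic time. -/
theorem quenched_pathCylinder_inter (x : Lattice d) (ω : Env d) (γ : ℕ → Lattice d) (n : ℕ)
    (y : Lattice d) :
    quenched x ω (pathCylinder γ n ∩ {X | X (n + 1) = y}) =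
      quenched x ω (pathCylinder γ n) * stepMeasure ω (γ n) {y} := by
  have h := congrArg (fun μ => μ ({fun i => γ i.1} ×ˢ {y}))
    (Kernel.partialTraj_compProd_eq_map_traj (X := fun _ => Lattice d) (κ := stepKernel ω)
      (Nat.zero_le n) (x₀ := fun _ => x))
  rw [Measure.compProd_apply_prod .of_discrete .of_discrete, lintegral_singleton,
    Measure.map_apply (by fun_prop) .of_discrete] at h
  have h1 : quenched x ω (pathCylinder γ n) =
      Kernel.partialTraj (X := fun _ => Lattice d) (stepKernel ω) 0 n (fun _ => x)
        {fun i => γ i.1} := by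
    rw [← Kernel.traj_map_frestrictLe_apply, Measure.map_apply (by fun_prop) .of_discrete,
      pathCylinder_eq_preimage]
    rfl
  rw [h1, mul_comm, pathCylinder_eq_preimage]
  exact h.symm

theorem quenched_pathCylinder_zero (x : Lattice d) (ω : Env d) (γ : ℕ → Lattice d) :
    quenched x ω (pathCylinder γ 0) = if γ 0 = x then 1 else 0 := by
  rw [pathCylinder_eq_preimage, ← Measure.map_apply (by fun_prop) .of_discrete, quenched,
    Kernel.traj_map_frestrictLe_apply, Kernel.partialTraj_self, Kernel.id_apply,
    Measure.dirac_apply' _ .of_discrete, Set.indicator_apply]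
  congr 1
  simp only [Set.mem_singleton_iff, funext_iff, Subtype.forall, Finset.mem_Iic, Nat.le_zero_eq,
    forall_eq, eq_comm]

/-- The position at time `n` of the walk from the origin with successive steps `s`. -/
def pos (s : ℕ → Dir d) (n : ℕ) : Lattice d := ∑ k ∈ Finset.range n, step (s k)

theorem pos_zero (s : ℕ → Dir d) : pos s 0 = 0 := by simp [pos]

theorem pos_succ (s : ℕ → Dir d) (n : ℕ) : pos s (n + 1) = pos s n + step (s n) :=
  Finset.sum_range_succ _ _

theorem pos_congr {s s' : ℕ → Dir d} {n : ℕ} (h : ∀ k < n, s k = s' k) : pos s n = pos s' n :=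
  Finset.sum_congr rfl fun k hk => by rw [h k (Finset.mem_range.1 hk)]

theorem quenched_pathCylinder_pos (ω : Env d) (s : ℕ → Dir d) (n : ℕ) :
    quenched 0 ω (pathCylinder (pos s) n) =
      ∏ k ∈ Finset.range n, ENNReal.ofReal ((ω (pos s k)).1 (s k)) := by
  induction n with
  | zero => rw [quenched_pathCylinder_zero, if_pos (pos_zero s), Finset.prod_range_zero]
  | succ n ih =>
    rw [pathCylinder_succ, quenched_pathCylinder_inter, ih, Finset.prod_range_succ, pos_succ,
      stepMeasure_add_step]

/-- A nearest-neighbour path from the origin is the sequence of positions of its steps. -/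
theorem exists_eq_pos [NeZero d] {γ : ℕ → Lattice d} {n : ℕ} (h0 : γ 0 = 0)
    (h : ∀ k < n, ∃ e, γ (k + 1) = γ k + step e) : ∃ s, ∀ k ≤ n, γ k = pos s k := by
  choose! s hs using h
  refine ⟨s, fun k => ?_⟩
  induction k with
  | zero => exact fun _ => by rw [h0, pos_zero]
  | succ k ih =>
    intro hk
    rw [hs k hk, pos_succ, ih (by omega)]

theorem quenched_pathCylinder_eq_zero (ω : Env d) {γ : ℕ → Lattice d} {n : ℕ}
    (h : ¬(γ 0 = 0 ∧ ∀ k < n, ∃ e, γ (k + 1) = γ k + step e)) :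
    quenched 0 ω (pathCylinder γ n) = 0 := by
  induction n with
  | zero =>
    rw [quenched_pathCylinder_zero, if_neg]
    exact fun h0 => h ⟨h0, by simp⟩
  | succ n ih =>
    rw [pathCylinder_succ, quenched_pathCylinder_inter]
    by_cases hn : γ 0 = 0 ∧ ∀ k < n, ∃ e, γ (k + 1) = γ k + step e
    · rw [stepMeasure_of_forall_ne, mul_zero]
      intro e he
      refine h ⟨hn.1, fun k hk => ?_⟩
      rcases Nat.lt_succ_iff_lt_or_eq.1 hk with hk | rfl
      · exact hn.2 k hk
      · exact ⟨e, he⟩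
    · rw [ih hn, zero_mul]

end Paths

/-! ### The annealed law -/

section Annealed

variable {d : ℕ} {α β : Fin d → ℝ}

theorem weights_pos (hα : ∀ i, 0 < α i) (hβ : ∀ i, 0 < β i) (e : Dir d) : 0 < weights α β e := by
  rcases e with i | i <;> simp [weights, hα, hβ]

theorem weights_swap (α β : Fin d → ℝ) (e : Dir d) : weights α β e.swap = weights β α e := by
  rcases e with i | i <;> simp [weights]

theorem sum_weights_pos [NeZero d] (hα : ∀ i, 0 < α i) (hβ : ∀ i, 0 < β i) : 0 < ∑ e, weights α β e :=
  Finset.sum_pos (fun e _ => weights_pos hα hβ e) ⟨Sum.inl 0, Finset.mem_univ _⟩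

theorem isProbabilityMeasure_annealed [NeZero d] (hα : ∀ i, 0 < α i) (hβ : ∀ i, 0 < β i) :
    IsProbabilityMeasure (annealed α β) := by
  have := isProbabilityMeasure_envLaw hα hβ
  constructor
  rw [annealed_apply _ _ .univ]
  simp_rw [fun ω : Env d => (isProbabilityMeasure_quenched 0 ω).measure_univ]
  simp

/-- The oriented edge crossed at time `k` by the walk with steps `s`, given by its origin and its
direction. -/
def jump (s : ℕ → Dir d) (k : ℕ) : Lattice d × Dir d := (pos s k, s k)

/-- The probability that the directed edge reinforced walk with initial weights `w` makes the first
`n` steps of `s`: the walk jumps in direction `e` with probability proportional to `w e` plus the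
number of earlier jumps in that direction from the current site. -/
noncomputable def pathWeight (w : Dir d → ℝ) (s : ℕ → Dir d) (n : ℕ) : ℝ :=
  (∏ k ∈ Finset.range n, (w (s k) + visits (jump s) k (jump s k))) /
    ∏ k ∈ Finset.range n, (∑ e, w e + visits (pos s) k (pos s k))

theorem pathWeight_succ (w : Dir d → ℝ) (s : ℕ → Dir d) (n : ℕ) :
    pathWeight w s (n + 1) = pathWeight w s n *
      ((w (s n) + visits (jump s) n (jump s n)) / (∑ e, w e + visits (pos s) n (pos s n))) := by
  rw [pathWeight, pathWeight, Finset.prod_range_succ, Finset.prod_range_succ, mul_div_mul_comm]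

/-- The annealed walk is a directed edge reinforced walk: integrating the product of the jump
probabilities gives one Dirichlet moment for each site of the path. -/
theorem annealed_pathCylinder_pos [NeZero d] (hα : ∀ i, 0 < α i) (hβ : ∀ i, 0 < β i) (s : ℕ → Dir d)
    (n : ℕ) :
    annealed α β (pathCylinder (pos s) n) = ENNReal.ofReal (pathWeight (weights α β) s n) := by
  have hw := weights_pos hα hβ
  have hW := sum_weights_pos hα hβ
  have hprob := isProbabilityMeasure_dirichlet (Sum.inl 0) hw
  have hF : ∀ k < n, pos s k ∈ (Finset.range n).image (pos s) := fun k hk =>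
    Finset.mem_image_of_mem _ (Finset.mem_range.2 hk)
  have hF' : ∀ k < n, jump s k ∈ (Finset.range n).image (pos s) ×ˢ Finset.univ := fun k hk =>
    Finset.mem_product.2 ⟨hF k hk, Finset.mem_univ _⟩
  -- group the factors of the quenched probability according to the site
  have hq : ∀ ω : Env d, quenched 0 ω (pathCylinder (pos s) n) =
      ∏ x ∈ (Finset.range n).image (pos s),
        ∏ e, ENNReal.ofReal ((ω x).1 e) ^ visits (jump s) n (x, e) := by
    intro ω
    rw [quenched_pathCylinder_pos, ← Finset.prod_product']
    refine (prod_range_visits (fun z _ => ENNReal.ofReal ((ω z.1).1 z.2)) (jump s) n _ hF').trans ?_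
    simp
  rw [annealed_apply _ _ (measurableSet_pathCylinder _ _)]
  simp_rw [hq]
  have hmeas : ∀ x, Measurable fun p : OpenSimplex (Dir d) =>
      ∏ e, ENNReal.ofReal (p.1 e) ^ visits (jump s) n (x, e) := fun x =>
    Finset.measurable_fun_prod _ fun e _ => (ENNReal.measurable_ofReal.comp
      ((measurable_pi_apply e).comp measurable_subtype_coe)).pow_const _
  rw [envLaw, lintegral_prod_eq_prod_lintegral_of_indepFun _
    (fun x (ω : Env d) => ∏ e, ENNReal.ofReal ((ω x).1 e) ^ visits (jump s) n (x, e))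
    (iIndepFun_infinitePi (X := fun x (p : OpenSimplex (Dir d)) =>
      ∏ e, ENNReal.ofReal (p.1 e) ^ visits (jump s) n (x, e)) hmeas)
    (fun x => (hmeas x).comp (measurable_pi_apply x))]
  have hint : ∀ x, ∫⁻ ω : Env d, ∏ e, ENNReal.ofReal ((ω x).1 e) ^ visits (jump s) n (x, e)
      ∂(Measure.infinitePi fun _ => dirichlet (Sum.inl 0) (weights α β)) =
      ENNReal.ofReal ((∏ e, ∏ i ∈ Finset.range (visits (jump s) n (x, e)), (weights α β e + i)) /
        ∏ i ∈ Finset.range (visits (pos s) n x), (∑ e, weights α β e + i)) := by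
    intro x
    have hm := lintegral_dirichlet_prod_pow (Sum.inl 0) hw fun e => visits (jump s) n (x, e)
    rw [show ∑ e, visits (jump s) n (x, e) = visits (pos s) n x from
      sum_visits_prodMk (pos s) s n x] at hm
    rw [← hm, ← (measurePreserving_eval_infinitePi
        (fun _ : Lattice d => dirichlet (Sum.inl 0) (weights α β)) x).lintegral_comp (hmeas x)]
  simp_rw [hint]
  rw [← ENNReal.ofReal_prod_of_nonneg, Finset.prod_div_distrib, pathWeight,
    prod_range_visits (fun _ i => ∑ e, weights α β e + i) (pos s) n _ hF,
    ← Finset.prod_product']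
  · congr 2
    exact (prod_range_visits (fun z i => weights α β z.2 + i) (jump s) n _ hF').symm
  · intro x _
    refine div_nonneg (Finset.prod_nonneg fun e _ => Finset.prod_nonneg fun i _ => ?_)
      (Finset.prod_nonneg fun i _ => by positivity)
    have := hw e
    positivity

theorem pathWeight_nonneg {w : Dir d → ℝ} (hw : ∀ e, 0 < w e) (s : ℕ → Dir d) (n : ℕ) :
    0 ≤ pathWeight w s n := by
  have hW : 0 ≤ ∑ e, w e := Finset.sum_nonneg fun e _ => (hw e).le
  refine div_nonneg (Finset.prod_nonneg fun k _ => ?_) (Finset.prod_nonneg fun k _ => ?_)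
  · have := hw (s k)
    positivity
  · positivity

theorem annealed_pathCylinder_eq_zero [NeZero d] (α β : Fin d → ℝ) {γ : ℕ → Lattice d} {n : ℕ}
    (h : ¬(γ 0 = 0 ∧ ∀ k < n, ∃ e, γ (k + 1) = γ k + step e)) :
    annealed α β (pathCylinder γ n) = 0 := by
  rw [annealed_apply _ _ (measurableSet_pathCylinder _ _)]
  simp_rw [fun ω => quenched_pathCylinder_eq_zero ω h]
  simp

/-- Almost surely, the walk starts at the origin and makes nearest-neighbour steps. -/
theorem ae_nearestNeighbour [NeZero d] (α β : Fin d → ℝ) :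
    ∀ᵐ X ∂(annealed α β), X 0 = 0 ∧ ∀ n, ∃ e, X (n + 1) = X n + step e := by
  have key : ∀ n, ∀ᵐ X ∂(annealed α β), X 0 = 0 ∧ ∀ k < n, ∃ e, X (k + 1) = X k + step e := by
    intro n
    refine measure_mono_null (t := ⋃ h : {h : Finset.Iic n → Lattice d //
      annealed α β (Preorder.frestrictLe (π := fun _ => Lattice d) n ⁻¹' {h}) = 0},
        Preorder.frestrictLe (π := fun _ => Lattice d) n ⁻¹' {h.1}) ?_
      (measure_iUnion_null fun h => h.2)
    intro X hX
    refine Set.mem_iUnion.2 ⟨⟨fun i => X i.1, ?_⟩, rfl⟩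
    rw [← pathCylinder_eq_preimage]
    exact annealed_pathCylinder_eq_zero α β hX
  filter_upwards [ae_all_iff.2 key] with X hX
  exact ⟨(hX 0).1, fun n => (hX (n + 1)).2 n n.lt_succ_self⟩

end Annealed

/-! ### Path reversal and the probability of going below the starting level -/

section Reversal

variable {d : ℕ}

theorem pos_reverse {s s' : ℕ → Dir d} {n : ℕ} (hs : ∀ k < n, s' k = (s (n - 1 - k)).swap) {k : ℕ}
    (hk : k ≤ n) : pos s' k = pos s (n - k) - pos s n := by
  induction k with
  | zero => simp [pos_zero]
  | succ k ih =>
    have h := pos_succ s (n - (k + 1))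
    rw [show n - (k + 1) + 1 = n - k by omega] at h
    rw [pos_succ, ih (by omega), hs k (by omega), step_swap, h,
      show n - 1 - k = n - (k + 1) by omega]
    abel

/-- The word of the opposite steps, in the reversed order. -/
def reverseWord {n : ℕ} (w : Fin n → Dir d) (i : Fin n) : Dir d := (w i.rev).swap

theorem reverseWord_reverseWord {n : ℕ} (w : Fin n → Dir d) : reverseWord (reverseWord w) = w := by
  funext i
  simp [reverseWord]

variable [NeZero d] {α β : Fin d → ℝ}

/-- Along the first `n` steps of `s`, the first coordinate stays nonnegative, and it ends at `0`. -/
def IsExcursion (s : ℕ → Dir d) (n : ℕ) : Prop := (∀ k ≤ n, 0 ≤ pos s k 0) ∧ pos s n 0 = 0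

theorem IsExcursion.reverse {s s' : ℕ → Dir d} {n : ℕ} (h : IsExcursion s n)
    (hs : ∀ k < n, s' k = (s (n - 1 - k)).swap) : IsExcursion s' n := by
  refine ⟨fun k hk => ?_, ?_⟩
  · rw [pos_reverse hs hk, Pi.sub_apply, h.2, sub_zero]
    exact h.1 _ (by omega)
  · rw [pos_reverse hs le_rfl, Pi.sub_apply, h.2, sub_zero, Nat.sub_self, pos_zero, Pi.zero_apply]

/-- A step `-e_1` from level `0` after an excursion has not been made before. -/
theorem IsExcursion.visits_down {s : ℕ → Dir d} {n : ℕ} (h : IsExcursion s n)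
    (hn : s n = Sum.inr 0) : visits (jump s) n (jump s n) = 0 := by
  refine Finset.card_eq_zero.2 (Finset.filter_eq_empty_iff.2 fun k hk hj => ?_)
  rw [Finset.mem_range] at hk
  simp only [jump, Prod.mk.injEq] at hj
  have h1 := h.1 (k + 1) hk
  rw [pos_succ, hj.1, hj.2, hn, Pi.add_apply, h.2, step_inr_zero_apply_zero] at h1
  omega

/-- The path made of an excursion and a final step `-e_1` becomes a closed path when its end points
are identified. Reversing it permutes its jumps and its sites, so that the weights of the two paths
differ only by the weight of the closing edge, which is `β 0` in one direction, and
`α 0` in the other one. -/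
theorem IsExcursion.pathWeight_reverse {s s' : ℕ → Dir d} {n : ℕ} (h : IsExcursion s n)
    (hs : ∀ k < n, s' k = (s (n - 1 - k)).swap) (hn : s n = Sum.inr 0) (hn' : s' n = Sum.inr 0) :
    α 0 * pathWeight (weights α β) s (n + 1) = β 0 * pathWeight (weights β α) s' (n + 1) := by
  have hsites : ∏ k ∈ Finset.range (n + 1), (∑ e, weights β α e + visits (pos s') k (pos s' k)) =
      ∏ k ∈ Finset.range (n + 1), (∑ e, weights α β e + visits (pos s) k (pos s k)) := by
    have hw : ∑ e, weights β α e = ∑ e, weights α β e := by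
      simp [weights, Fintype.sum_sum_type, add_comm]
    rw [hw]
    refine prod_range_visits_reverse (g := fun _ i => ∑ e, weights α β e + (i : ℝ))
      (g' := fun _ i => ∑ e, weights α β e + (i : ℝ)) (φ := fun x => x - pos s n)
      (sub_left_injective) (fun k hk => ?_) fun _ _ => rfl
    rw [pos_reverse hs (by omega), show n + 1 - 1 - k = n - k by omega]
  have hjumps : ∏ k ∈ Finset.range n, (weights β α (s' k) + visits (jump s') k (jump s' k)) =
      ∏ k ∈ Finset.range n, (weights α β (s k) + visits (jump s) k (jump s k)) := by
    refine prod_range_visits_reverse (g := fun z i => weights α β z.2 + (i : ℝ))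
      (g' := fun z i => weights β α z.2 + (i : ℝ)) (y := jump s) (y' := jump s')
      (φ := fun z => (z.1 + step z.2 - pos s n, z.2.swap)) ?_ (fun k hk => ?_) fun z i => ?_
    · rintro ⟨x, e⟩ ⟨x', e'⟩ hxe
      simp only [Prod.mk.injEq] at hxe
      have he := Sum.swap_leftInverse.injective hxe.2
      subst he
      simpa using hxe.1
    · rw [jump, pos_reverse hs hk.le, hs k hk, jump, ← pos_succ,
        show n - 1 - k + 1 = n - k by omega]
    · simp only [weights_swap]
  have hd := h.visits_down hn
  have hd' := (h.reverse hs).visits_down hn'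
  rw [pathWeight, pathWeight, hsites,
    Finset.prod_range_succ (fun k => weights α β (s k) + (visits (jump s) k (jump s k) : ℝ)),
    Finset.prod_range_succ (fun k => weights β α (s' k) + (visits (jump s') k (jump s' k) : ℝ)),
    hjumps, hd, hd', hn, hn']
  simp only [weights, Sum.elim_inr, Nat.cast_zero, add_zero]
  ring

/-- The infinite word made of the word `w` followed by steps `-e_1`. -/
def extendDown {n : ℕ} (w : Fin n → Dir d) (k : ℕ) : Dir d :=
  if h : k < n then w ⟨k, h⟩ else Sum.inr 0

theorem extendDown_self {n : ℕ} (w : Fin n → Dir d) : extendDown w n = Sum.inr 0 := by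
  simp [extendDown]

theorem extendDown_of_lt {n : ℕ} (w : Fin n → Dir d) {k : ℕ} (hk : k < n) :
    extendDown w k = w ⟨k, hk⟩ := dif_pos hk

theorem extendDown_reverseWord {n : ℕ} (w : Fin n → Dir d) (k : ℕ) (hk : k < n) :
    extendDown (reverseWord w) k = (extendDown w (n - 1 - k)).swap := by
  rw [extendDown_of_lt _ hk, extendDown_of_lt _ (by omega), reverseWord]
  congr 2
  ext
  simp [Fin.val_rev]
  omega

/-- The trajectories whose first coordinate becomes negative for the first time at time `n + 1`. -/
def firstNegAt (d : ℕ) [NeZero d] (n : ℕ) : Set (ℕ → Lattice d) :=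
  {X | (∀ k ≤ n, 0 ≤ X k 0) ∧ X (n + 1) 0 < 0}

theorem measurableSet_firstNegAt (n : ℕ) : MeasurableSet (firstNegAt d n) := by
  have h : ∀ k, Measurable fun X : ℕ → Lattice d => X k 0 := fun k =>
    (measurable_pi_apply 0).comp (measurable_pi_apply k)
  have : firstNegAt d n = (⋂ k, ⋂ (_ : k ≤ n), {X | 0 ≤ X k 0}) ∩ {X | X (n + 1) 0 < 0} := by
    ext X
    simp [firstNegAt]
  rw [this]
  exact (MeasurableSet.iInter fun k => MeasurableSet.iInter fun _ =>
    measurableSet_le measurable_const (h k)).inter (measurableSet_lt (h _) measurable_const)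

open Classical in
theorem annealed_firstNegAt_eq_sum (hα : ∀ i, 0 < α i) (hβ : ∀ i, 0 < β i) (n : ℕ) :
    annealed α β (firstNegAt d n) =
      ∑ w ∈ Finset.univ.filter fun w : Fin n → Dir d => IsExcursion (extendDown w) n,
        ENNReal.ofReal (pathWeight (weights α β) (extendDown w) (n + 1)) := by
  have hU : firstNegAt d n =ᵐ[annealed α β]
      ⋃ w ∈ Finset.univ.filter fun w : Fin n → Dir d => IsExcursion (extendDown w) n,
        pathCylinder (pos (extendDown w)) (n + 1) := by
    filter_upwards [ae_nearestNeighbour α β] with X hX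
    refine propext ⟨fun h => ?_, fun h => ?_⟩
    · obtain ⟨s, hs⟩ := exists_eq_pos (n := n + 1) hX.1 fun k _ => hX.2 k
      -- the last step has to be `-e_1`, and to start from level `0`
      have hn := hs (n + 1) le_rfl
      have h1 := h.2
      have h0 := h.1 n le_rfl
      rw [hn, pos_succ, Pi.add_apply] at h1
      rw [hs n (by omega)] at h0
      have hsn : s n = Sum.inr 0 := (step_apply_zero_neg_iff _).1 (by omega)
      rw [hsn, step_inr_zero_apply_zero] at h1
      have hext : ∀ k < n + 1, extendDown (fun i : Fin n => s i) k = s k := by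
        intro k hk
        rcases Nat.lt_succ_iff_lt_or_eq.1 hk with hk | rfl
        · rw [extendDown_of_lt _ hk]
        · rw [extendDown_self, hsn]
      have hpos : ∀ k ≤ n + 1, pos (extendDown fun i : Fin n => s i) k = pos s k := fun k hk =>
        pos_congr fun j hj => hext j (by omega)
      refine Set.mem_iUnion₂.2 ⟨fun i => s i, ?_, fun k hk => by rw [hpos k hk, hs k hk]⟩
      refine Finset.mem_filter.2 ⟨Finset.mem_univ _, fun k hk => ?_, ?_⟩
      · rw [hpos k (by omega), ← hs k (by omega)]
        exact h.1 k hk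
      · rw [hpos n (by omega)]
        omega
    · obtain ⟨w, hw, hXw⟩ := Set.mem_iUnion₂.1 h
      have hw' := (Finset.mem_filter.1 hw).2
      refine ⟨fun k hk => ?_, ?_⟩
      · rw [hXw k (by omega)]
        exact hw'.1 k hk
      · rw [hXw (n + 1) le_rfl, pos_succ, extendDown_self, Pi.add_apply, hw'.2,
          step_inr_zero_apply_zero]
        norm_num
  rw [measure_congr hU, measure_biUnion_finset _ fun w _ => measurableSet_pathCylinder _ _]
  · exact Finset.sum_congr rfl fun w _ => annealed_pathCylinder_pos hα hβ _ _
  · intro w _ w' _ hne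
    refine Set.disjoint_left.2 fun X hX hX' => hne ?_
    funext i
    have h1 := hX (i + 1) (by omega)
    have h1' := hX' (i + 1) (by omega)
    rw [pos_succ, ← hX i (by omega), extendDown_of_lt _ i.2] at h1
    rw [pos_succ, ← hX' i (by omega), extendDown_of_lt _ i.2, h1] at h1'
    exact step_injective (add_left_cancel h1')

/-- Path reversal exchanges the roles of `α` and `β`. -/
theorem annealed_firstNegAt_swap (hα : ∀ i, 0 < α i) (hβ : ∀ i, 0 < β i) (n : ℕ) :
    annealed α β (firstNegAt d n) =
      ENNReal.ofReal (β 0 / α 0) * annealed β α (firstNegAt d n) := by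
  classical
  rw [annealed_firstNegAt_eq_sum hα hβ, annealed_firstNegAt_eq_sum hβ hα, Finset.mul_sum]
  have hmem : ∀ w : Fin n → Dir d, IsExcursion (extendDown w) n →
      IsExcursion (extendDown (reverseWord w)) n := fun w hw =>
    hw.reverse (extendDown_reverseWord w)
  refine Finset.sum_bij' (fun w _ => reverseWord w) (fun w _ => reverseWord w) ?_ ?_ ?_ ?_ ?_
  · exact fun w hw => by simpa using hmem w (by simpa using hw)
  · exact fun w hw => by simpa using hmem w (by simpa using hw)
  · exact fun w _ => reverseWord_reverseWord w
  · exact fun w _ => reverseWord_reverseWord w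
  · intro w hw
    have h := IsExcursion.pathWeight_reverse (α := α) (β := β) (by simpa using hw)
      (extendDown_reverseWord w) (extendDown_self w) (extendDown_self _)
    have h0 := hα 0
    have h1 := hβ 0
    rw [← ENNReal.ofReal_mul (by positivity)]
    congr 1
    field_simp
    linarith

theorem firstNegTime_eq_top_iff (X : ℕ → Lattice d) :
    firstNegTime X = ⊤ ↔ ∀ n, 0 ≤ X n 0 := by
  simp [firstNegTime, iInf_eq_top]

theorem annealed_exists_neg_le (hα : ∀ i, 0 < α i) (hβ : ∀ i, 0 < β i) :
    annealed α β {X | ∃ n, X n 0 < 0} ≤ ENNReal.ofReal (β 0 / α 0) := by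
  have hprob := isProbabilityMeasure_annealed hβ hα
  have hsub : {X | ∃ n, X n 0 < 0} ≤ᵐ[annealed α β] ⋃ n, firstNegAt d n := by
    filter_upwards [ae_nearestNeighbour α β] with X hX h
    obtain ⟨hn, hmin⟩ := Nat.find_spec h, fun k => Nat.find_min h (m := k)
    rcases hN : Nat.find h with _ | n
    · rw [hN, hX.1] at hn
      exact absurd hn (lt_irrefl _)
    · rw [hN] at hn hmin
      exact Set.mem_iUnion.2 ⟨n, fun k hk => not_lt.1 (hmin k (by omega)), hn⟩
  have hdisj : Pairwise (Function.onFun Disjoint (firstNegAt d)) := by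
    have : ∀ m n, m < n → Disjoint (firstNegAt d m) (firstNegAt d n) := fun m n hmn =>
      Set.disjoint_left.2 fun X hX hX' => (hX'.1 (m + 1) hmn).not_gt hX.2
    intro m n hmn
    rcases hmn.lt_or_gt with h | h
    · exact this m n h
    · exact (this n m h).symm
  calc annealed α β {X | ∃ n, X n 0 < 0}
      ≤ annealed α β (⋃ n, firstNegAt d n) := measure_mono_ae hsub
    _ ≤ ∑' n, annealed α β (firstNegAt d n) := measure_iUnion_le _
    _ = ENNReal.ofReal (β 0 / α 0) * annealed β α (⋃ n, firstNegAt d n) := by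
        simp_rw [annealed_firstNegAt_swap hα hβ]
        rw [ENNReal.tsum_mul_left, measure_iUnion hdisj measurableSet_firstNegAt]
    _ ≤ ENNReal.ofReal (β 0 / α 0) := mul_le_of_le_one_right' prob_le_one

theorem annealed_firstNegTime_eq_top_ge (hα : ∀ i, 0 < α i) (hβ : ∀ i, 0 < β i) :
    ENNReal.ofReal (1 - β 0 / α 0) ≤ annealed α β {X | firstNegTime X = ⊤} := by
  have hprob := isProbabilityMeasure_annealed hα hβ
  have hm : MeasurableSet {X : ℕ → Lattice d | ∃ n, X n 0 < 0} := by
    rw [Set.ofPred_exists]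
    exact MeasurableSet.iUnion fun n => measurableSet_lt
      ((measurable_pi_apply 0).comp (measurable_pi_apply n)) measurable_const
  have hc : {X : ℕ → Lattice d | firstNegTime X = ⊤} = {X | ∃ n, X n 0 < 0}ᶜ := by
    ext X
    simp [firstNegTime_eq_top_iff]
  rw [hc, prob_compl_eq_one_sub hm, ENNReal.ofReal_sub _ (div_pos (hβ 0) (hα 0)).le,
    ENNReal.ofReal_one]
  exact tsub_le_tsub_left (annealed_exists_neg_le hα hβ) _

end Reversal

/-! ### Directional transience of the walks that stay on the nonnegative side -/

section Transience

theorem visits_le {Y : Type*} [DecidableEq Y] (y : ℕ → Y) (n : ℕ) (z : Y) : visits y n z ≤ n := by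
  simpa [visits] using Finset.card_filter_le (Finset.range n) fun k => y k = z

theorem monotone_visits {Y : Type*} [DecidableEq Y] (y : ℕ → Y) (z : Y) :
    Monotone fun n => visits y n z :=
  monotone_nat_of_le_succ fun n => by simp [visits_succ]

theorem tendsto_visits_atTop {Y : Type*} [DecidableEq Y] {y : ℕ → Y} {z : Y}
    (h : ∃ᶠ n in atTop, y n = z) : Tendsto (fun n => visits y n z) atTop atTop := by
  refine tendsto_atTop_atTop_of_monotone (monotone_visits y z) fun b => ?_
  induction b with
  | zero => exact ⟨0, Nat.zero_le _⟩
  | succ b ih =>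
    obtain ⟨n, hn⟩ := ih
    obtain ⟨m, hm, hy⟩ := (frequently_atTop.1 h) n
    refine ⟨m + 1, ?_⟩
    have := monotone_visits y z hm
    simp only at this
    rw [visits_succ, if_pos hy]
    omega

theorem sum_range_ite_visits {Y : Type*} [DecidableEq Y] (g : ℕ → ℝ) (y : ℕ → Y) (z : Y) (n : ℕ) :
    (∑ k ∈ Finset.range n, if y k = z then g (visits y k z) else 0) =
      ∑ i ∈ Finset.range (visits y n z), g i := by
  induction n with
  | zero => simp [visits_zero]
  | succ n ih =>
    rw [Finset.sum_range_succ, ih, visits_succ]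
    split_ifs
    · rw [Finset.sum_range_succ]
    · simp

theorem tendsto_sum_range_div_add_atTop {b W : ℝ} (hb : 0 < b) (hW : 0 < W) :
    Tendsto (fun n => ∑ i ∈ Finset.range n, b / (W + i)) atTop atTop := by
  have h := (Real.tendsto_sum_range_one_div_nat_succ_atTop).const_mul_atTop
    (show 0 < b / (W + 1) by positivity)
  refine tendsto_atTop_mono (fun n => ?_) h
  rw [Finset.mul_sum]
  refine Finset.sum_le_sum fun i _ => ?_
  rw [div_mul_div_comm, mul_one]
  refine div_le_div_of_nonneg_left hb.le (by positivity) ?_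
  have : (0 : ℝ) ≤ i := i.cast_nonneg
  nlinarith

variable {d : ℕ} [NeZero d] {α β : Fin d → ℝ}

/-- The trajectories which jump from level `u` in direction `-e_1` between the times `k` and
`k + 1`. The set is indexed by the time `k + 1`, so that it is adapted. -/
def downJump (u : ℤ) : ℕ → Set (ℕ → Lattice d)
  | 0 => ∅
  | k + 1 => {X | X k 0 = u ∧ X (k + 1) = X k + step (Sum.inr 0)}

/-- The conditional annealed probability of `downJump u (k + 1)` given the trajectory up to
time `k`. -/
noncomputable def downProb (α β : Fin d → ℝ) (u : ℤ) (k : ℕ) (X : ℕ → Lattice d) : ℝ :=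
  if X k 0 = u then
    (β 0 + visits (fun j => (X j, X (j + 1))) k (X k, X k + step (Sum.inr 0))) /
      (∑ e, weights α β e + visits X k (X k))
  else 0

theorem downProb_congr (α β : Fin d → ℝ) (u : ℤ) {k : ℕ} {X X' : ℕ → Lattice d}
    (h : ∀ j ≤ k, X j = X' j) : downProb α β u k X = downProb α β u k X' := by
  unfold downProb
  rw [h k le_rfl, visits_congr (y := X) (y' := X') fun j hj => h j hj.le,
    visits_congr (y := fun j => (X j, X (j + 1))) (y' := fun j => (X' j, X' (j + 1)))
      fun j hj => by simp only [h j hj.le, h (j + 1) hj]]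

theorem downProb_nonneg (hα : ∀ i, 0 < α i) (hβ : ∀ i, 0 < β i) (u : ℤ) (k : ℕ)
    (X : ℕ → Lattice d) : 0 ≤ downProb α β u k X := by
  have := sum_weights_pos hα hβ
  have := hβ 0
  unfold downProb
  split_ifs <;> positivity

theorem downProb_le (hα : ∀ i, 0 < α i) (hβ : ∀ i, 0 < β i) (u : ℤ) (k : ℕ)
    (X : ℕ → Lattice d) : downProb α β u k X ≤ (β 0 + k) / ∑ e, weights α β e := by
  have := sum_weights_pos hα hβ
  have := hβ 0
  unfold downProb
  split_ifs
  · gcongr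
    · exact Nat.cast_le.2 (visits_le _ _ _)
    · simp
  · positivity

theorem le_downProb (hα : ∀ i, 0 < α i) (hβ : ∀ i, 0 < β i) (u : ℤ) (k : ℕ) (X : ℕ → Lattice d) :
    (if X k 0 = u then β 0 / (∑ e, weights α β e + visits (fun j => X j 0) k u) else 0) ≤
      downProb α β u k X := by
  have := sum_weights_pos hα hβ
  have := hβ 0
  unfold downProb
  split_ifs with hu
  · gcongr
    · simp
    · refine Finset.card_le_card fun j hj => ?_
      rw [Finset.mem_filter] at hj ⊢
      exact ⟨hj.1, (congrFun hj.2 0).trans hu⟩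
  · exact le_rfl

theorem annealed_pathCylinder_inter_downJump (hα : ∀ i, 0 < α i) (hβ : ∀ i, 0 < β i) (u : ℤ)
    (k : ℕ) (γ : ℕ → Lattice d) :
    annealed α β (pathCylinder γ k ∩ downJump u (k + 1)) =
      ENNReal.ofReal (downProb α β u k γ) * annealed α β (pathCylinder γ k) := by
  by_cases hu : γ k 0 = u
  swap
  · have : pathCylinder γ k ∩ downJump u (k + 1) = ∅ := by
      refine Set.eq_empty_of_forall_notMem fun X hX => hu ?_
      rw [← hX.1 k le_rfl]
      exact hX.2.1
    rw [this, downProb, if_neg hu]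
    simp
  by_cases hγ : γ 0 = 0 ∧ ∀ j < k, ∃ e, γ (j + 1) = γ j + step e
  swap
  · have h0 := annealed_pathCylinder_eq_zero α β hγ
    rw [h0, mul_zero]
    exact measure_mono_null Set.inter_subset_left h0
  obtain ⟨s₀, hs₀⟩ := exists_eq_pos hγ.1 hγ.2
  obtain ⟨s, hsk, hs⟩ : ∃ s : ℕ → Dir d, s k = Sum.inr 0 ∧ ∀ j ≤ k, γ j = pos s j := by
    refine ⟨Function.update s₀ k (Sum.inr 0), by simp, fun j hj => ?_⟩
    rw [hs₀ j hj]
    exact pos_congr fun i hi => by rw [Function.update_of_ne (by omega)]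
  have hset : pathCylinder γ k ∩ downJump u (k + 1) = pathCylinder (pos s) (k + 1) := by
    rw [pathCylinder_congr hs, pathCylinder_succ]
    ext X
    refine and_congr_right fun hX => ?_
    have hXk := hX k le_rfl
    simp only [downJump, Set.mem_ofPred_eq, pos_succ, hsk, hXk]
    rw [← hs k le_rfl]
    exact and_iff_right hu
  have hv : visits (jump s) k (jump s k) =
      visits (fun j => (pos s j, pos s (j + 1))) k (pos s k, pos s k + step (Sum.inr 0)) := by
    unfold visits
    congr 1
    refine Finset.filter_congr fun j _ => ?_
    simp only [jump, Prod.mk.injEq, hsk, pos_succ]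
    refine and_congr_right fun hj => ?_
    rw [hj, add_right_inj, step_injective.eq_iff]
  rw [hset, downProb_congr α β u hs, pathCylinder_congr hs, annealed_pathCylinder_pos hα hβ,
    annealed_pathCylinder_pos hα hβ, pathWeight_succ, mul_comm,
    ENNReal.ofReal_mul' (pathWeight_nonneg (weights_pos hα hβ) _ _), downProb,
    if_pos (by rw [← hs k le_rfl, hu]), hv, hsk]
  rfl

/-- The trajectory with values `h` up to time `k`, and `0` afterwards. -/
def extendPath {k : ℕ} (h : Finset.Iic k → Lattice d) (j : ℕ) : Lattice d :=
  if hj : j ≤ k then h ⟨j, Finset.mem_Iic.2 hj⟩ else 0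

theorem downProb_eq_comp (α β : Fin d → ℝ) (u : ℤ) (k : ℕ) :
    downProb α β u k = (fun h => downProb α β u k (extendPath h)) ∘
      Preorder.frestrictLe (π := fun _ => Lattice d) k := by
  funext X
  exact downProb_congr α β u fun j hj => by simp [extendPath, hj]

theorem measurableSet_downJump (u : ℤ) (k : ℕ) :
    MeasurableSet[Filtration.piLE (X := fun _ => Lattice d) k] (downJump (d := d) u k) := by
  cases k with
  | zero => exact @MeasurableSet.empty _ (Filtration.piLE (X := fun _ => Lattice d) 0)
  | succ k =>
    rw [Filtration.piLE_eq_comap_frestrictLe]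
    refine ⟨{h | h ⟨k, Finset.mem_Iic.2 k.le_succ⟩ 0 = u ∧ h ⟨k + 1, Finset.mem_Iic.2 le_rfl⟩ =
      h ⟨k, Finset.mem_Iic.2 k.le_succ⟩ + step (Sum.inr 0)}, .of_discrete, rfl⟩

theorem measurable_downProb (α β : Fin d → ℝ) (u : ℤ) (k : ℕ) :
    Measurable[Filtration.piLE (X := fun _ => Lattice d) k] (downProb α β u k) := by
  rw [downProb_eq_comp, Filtration.piLE_eq_comap_frestrictLe]
  exact (measurable_of_countable _).comp (comap_measurable _)

theorem setLIntegral_downProb (hα : ∀ i, 0 < α i) (hβ : ∀ i, 0 < β i) (u : ℤ) (k : ℕ)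
    {A : Set (ℕ → Lattice d)} (hA : MeasurableSet[Filtration.piLE (X := fun _ => Lattice d) k] A) :
    ∫⁻ X in A, ENNReal.ofReal (downProb α β u k X) ∂(annealed α β) =
      annealed α β (A ∩ downJump u (k + 1)) := by
  have hm : MeasurableSet (downJump (d := d) u (k + 1)) :=
    (Filtration.piLE (X := fun _ => Lattice d)).le _ _ (measurableSet_downJump u (k + 1))
  have hfr := Preorder.measurable_frestrictLe (X := fun _ => Lattice d) k
  -- both sides are measures of the path up to time `k`, which takes countably many values
  have heq : ((annealed α β).withDensity fun X => ENNReal.ofReal (downProb α β u k X)).map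
      (Preorder.frestrictLe k) =
      ((annealed α β).restrict (downJump u (k + 1))).map (Preorder.frestrictLe k) := by
    refine Measure.ext_of_singleton fun h => ?_
    have hcyl : Preorder.frestrictLe (π := fun _ => Lattice d) k ⁻¹' {h} =
        pathCylinder (extendPath h) k := by
      rw [pathCylinder_eq_preimage]
      congr 2
      funext i
      simp [extendPath, Finset.mem_Iic.1 i.2]
    rw [Measure.map_apply hfr .of_discrete, Measure.map_apply hfr .of_discrete, hcyl,
      withDensity_apply _ (measurableSet_pathCylinder _ _),
      Measure.restrict_apply (measurableSet_pathCylinder _ _),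
      annealed_pathCylinder_inter_downJump hα hβ, ← setLIntegral_const]
    exact setLIntegral_congr_fun (measurableSet_pathCylinder _ _) fun X hX => by
      rw [downProb_congr α β u hX]
  have hA' : MeasurableSet A := (Filtration.piLE (X := fun _ => Lattice d)).le _ _ hA
  rw [Filtration.piLE_eq_comap_frestrictLe] at hA
  obtain ⟨B, hB, rfl⟩ := hA
  have h := congrArg (fun μ => μ B) heq
  rwa [Measure.map_apply hfr hB, Measure.map_apply hfr hB, withDensity_apply _ hA',
    Measure.restrict_apply hA'] at h

theorem downProb_ae_eq_condExp (hα : ∀ i, 0 < α i) (hβ : ∀ i, 0 < β i) (u : ℤ) (k : ℕ) :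
    downProb α β u k =ᵐ[annealed α β] (annealed α β)[(downJump u (k + 1)).indicator
      (1 : (ℕ → Lattice d) → ℝ) | Filtration.piLE (X := fun _ => Lattice d) k] := by
  have hprob := isProbabilityMeasure_annealed hα hβ
  have hle := (Filtration.piLE (X := fun _ : ℕ => Lattice d)).le k
  have hm : MeasurableSet (downJump (d := d) u (k + 1)) :=
    (Filtration.piLE (X := fun _ => Lattice d)).le _ _ (measurableSet_downJump u (k + 1))
  have hmeas := measurable_downProb α β u k
  have hint : Integrable (downProb α β u k) (annealed α β) := by
    refine .of_bound (hmeas.mono hle le_rfl).aestronglyMeasurable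
      ((β 0 + k) / ∑ e, weights α β e) (.of_forall fun X => ?_)
    rw [Real.norm_of_nonneg (downProb_nonneg hα hβ u k X)]
    exact downProb_le hα hβ u k X
  refine ae_eq_condExp_of_forall_setIntegral_eq hle ((integrable_const 1).indicator hm)
    (fun A _ _ => hint.integrableOn) (fun A hA _ => ?_) hmeas.stronglyMeasurable.aestronglyMeasurable
  rw [integral_indicator_one hm, integral_eq_lintegral_of_nonneg_ae
    (.of_forall (downProb_nonneg hα hβ u k)) hint.aestronglyMeasurable.restrict,
    setLIntegral_downProb hα hβ u k hA, measureReal_def, Measure.restrict_apply hm, Set.inter_comm]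

/-- Almost surely, a level which is visited infinitely often is left infinitely often in direction
`-e_1`: the conditional probabilities of these jumps are at least of the order of the inverse of the
number of visits, so that their sum diverges. -/
theorem ae_frequently_level_pred (hα : ∀ i, 0 < α i) (hβ : ∀ i, 0 < β i) (u : ℤ) :
    ∀ᵐ X ∂(annealed α β), (∃ᶠ n in atTop, X n 0 = u) → ∃ᶠ n in atTop, X n 0 = u - 1 := by
  have hprob := isProbabilityMeasure_annealed hα hβ
  filter_upwards [ae_mem_limsup_atTop_iff (annealed α β) (measurableSet_downJump (d := d) u),
    ae_all_iff.2 fun k => downProb_ae_eq_condExp hα hβ u k] with X hX hk hfreq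
  have hdiv := (tendsto_sum_range_div_add_atTop (hβ 0) (sum_weights_pos hα hβ)).comp
    (tendsto_visits_atTop hfreq)
  have hmem : X ∈ limsup (downJump u) atTop := by
    refine hX.2 (tendsto_atTop_mono (fun n => ?_) hdiv)
    rw [Function.comp_apply,
      ← sum_range_ite_visits (fun i => β 0 / (∑ e, weights α β e + i)) (fun j => X j 0) u n]
    refine Finset.sum_le_sum fun k _ => ?_
    rw [← hk k]
    exact le_downProb hα hβ u k X
  rw [mem_limsup_iff_frequently_mem] at hmem
  refine hmem.mono fun n hn => ?_
  cases n with
  | zero => exact hn.elim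
  | succ n =>
    rw [hn.2, Pi.add_apply, hn.1, step_inr_zero_apply_zero]
    rfl

theorem tendsto_atTop_of_frequently_level_pred {y : ℕ → ℤ} (h0 : ∀ n, 0 ≤ y n)
    (h : ∀ u : ℤ, (∃ᶠ n in atTop, y n = u) → ∃ᶠ n in atTop, y n = u - 1) :
    Tendsto y atTop atTop := by
  have hne : ∀ m : ℕ, ∀ᶠ n in atTop, y n ≠ m := by
    intro m
    rw [← not_frequently]
    induction m with
    | zero =>
      intro hf
      obtain ⟨n, hn⟩ := (h _ hf).exists
      have := h0 n
      simp only [Nat.cast_zero] at hn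
      omega
    | succ m ih => exact fun hf => ih (by simpa using h _ hf)
  have hge : ∀ m : ℕ, ∀ᶠ n in atTop, (m : ℤ) ≤ y n := by
    intro m
    induction m with
    | zero => exact .of_forall h0
    | succ m ih =>
      filter_upwards [ih, hne m] with n h1 h2
      push_cast
      omega
  exact tendsto_atTop.2 fun b => (hge b.toNat).mono fun n hn => (Int.self_le_toNat b).trans hn

theorem annealed_firstNegTime_eq_top_le (hα : ∀ i, 0 < α i) (hβ : ∀ i, 0 < β i) :
    annealed α β {X | firstNegTime X = ⊤} ≤
      annealed α β {X | Tendsto (fun n => X n 0) atTop atTop} := by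
  refine measure_mono_ae ?_
  filter_upwards [ae_all_iff.2 (ae_frequently_level_pred hα hβ)] with X hX hD
  exact tendsto_atTop_of_frequently_level_pred ((firstNegTime_eq_top_iff X).1 hD) hX

end Transience

end DirichletRWRE

theorem theorem1 (d : ℕ) [NeZero d] (α β : Fin d → ℝ) (hα : ∀ i, 0 < α i) (hβ : ∀ i, 0 < β i)
    (h : β 0 < α 0) :
    0 < DirichletRWRE.annealed α β {X | Tendsto (fun n => X n 0) atTop atTop} ∧
      ENNReal.ofReal (1 - β 0 / α 0) ≤
        DirichletRWRE.annealed α β {X | DirichletRWRE.firstNegTime X = ⊤} := by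
  have hge := DirichletRWRE.annealed_firstNegTime_eq_top_ge hα hβ
  have hpos : 0 < ENNReal.ofReal (1 - β 0 / α 0) :=
    ENNReal.ofReal_pos.2 (sub_pos.2 ((div_lt_one (hα 0)).2 h))
  exact ⟨(hpos.trans_le hge).trans_le (DirichletRWRE.annealed_firstNegTime_eq_top_le hα hβ), hge⟩
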